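/- Let $\tau,\eta\in\mathbb C$ with $\operatorname{Im}\tau>0$, put $q=e^{i\pi\tau}$ and $$\theta_1(u)=-i\sum_{k\in\mathbb Z}(-1)^kq^{(k+1/2)^2}e^{i\pi(2k+1)u},\qquad \theta_2(u)=\sum_{k\in\mathbb Z}q^{(k+1/2)^2}e^{i\pi(2k+1)u},$$ $$\theta_3(u)=\sum_{k\in\mathbb Z}q^{k^2}e^{2i\pi ku},\qquad \theta_4(u)=\sum_{k\in\mathbb Z}(-1)^kq^{k^2}e^{2i\pi ku},$$ where $q^x$ means $e^{i\pi\tau x}$. Put $k_i=\theta_{5-i}$ $(i=1,\dots,4)$ and assume $k_i(\eta/2)\neq0$ for all $i$. With $\sigma^1,\sigma^2,\sigma^3=\sigma^x,\sigma^y,\sigma^z$ the Pauli matrices and $\sigma^4=\mathbb I$, let the XYZ $R$-matrix be $$R_{0,j}(u)=\sum_{i=1}^4w_i(u)\,\sigma^i_0\sigma^i_j,\qquad w_i(u)=\frac{k_i(u+\eta/2)}{2k_i(\eta/2)},$$ and let $\mathcal L_{0,j}(u)=R_{0,j}(u-\eta/2)$. For a twist $G\in\{\mathbb I,\sigma^x,\sigma^y,\sigma^z\}$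 let the transfer matrix on $(\mathbb C^2)^{\otimes L}$ be $t(u)=\mathrm{Tr}_0\big(G_0\,\mathcal L_{0,L}(u)\cdots\mathcal L_{0,1}(u)\big)$. For $\alpha_1,\dots,\alpha_4\in\mathbb C$ let $$K(u)=\frac{\alpha_1}{k_1(u)}\sigma^x+\frac{\alpha_2}{k_2(u)}\sigma^y+\frac{\alpha_3}{k_3(u)}\sigma^z+\frac{\alpha_4}{k_4(u)}\mathbb I,\qquad |\psi_K\rangle=\sum_{i,j=1}^2[K(\eta/2)\sigma^y]_{ij}\,|i\rangle\otimes|j\rangle .$$ Then the following hold, each identity being for all $u\in\mathbb C$. 1. ($G=\mathbb I$, $L$ even.) For all $\alpha_1,\dots,\alpha_4$, the state $\Psi=|\psi_K\rangle^{\otimes L/2}$ satisfies $t(u)\Psi=t(-u)\Psi$. Moreover every vector of $\mathbb C^2\otimes\mathbb C^2$ equals $|\psi_K\rangle$ for suitable $\alpha_1,\dots,\alpha_4$. 2. ($G=\sigma^\alpha$, $\alpha\in\{x,y,z\}$, $L$ even.) Let $\epsilon\in\{1,-1\}$. If $\sigma^yK^{\mathrm t}(-u)\sigma^yG=\epsilon\,G\sigma^yK^{\mathrm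 t}(-u)\sigma^y$ for all $u$ at which $K(-u)$ is defined (i.e. $k_i(-u)\ne0$ for all $i$), then $\Psi=|\psi_K\rangle^{\otimes L/2}$ satisfies $t(u)\Psi=\epsilon\,t(-u)\Psi$. Explicitly, if $\sigma^\alpha|\varphi_\pm\rangle=\pm|\varphi_\pm\rangle$ and $a_\pm\in\mathbb C$, then $$\Psi_{+,e}=\Big(\sum_{\sigma=\pm}a_\sigma|\varphi_\sigma\rangle\otimes|\varphi_{-\sigma}\rangle\Big)^{\otimes L/2},\qquad \Psi_{-,e}=\Big(\sum_{\sigma=\pm}a_\sigma|\varphi_\sigma\rangle\otimes|\varphi_\sigma\rangle\Big)^{\otimes L/2}$$ satisfy $t(u)\Psi_{\pm,e}=\pm t(-u)\Psi_{\pm,e}$. 3. ($G=\mathbb I$, $L$ odd.) For every $a\in\mathbb C$, $\Psi_{-,o}=\binom1a^{\otimes L}$ satisfies $t(u)\Psi_{-,o}=-t(-u)\Psi_{-,o}$. 4. ($G=\sigma^\alpha$, $\alpha\in\{x,y,z\}$, $L$ odd.) For every $a\in\mathbb C$, $\Psi_{+,o}=\Big(\prod_{n\ \mathrm{even}}\sigma^\alpha_n\Big)\binom1a^{\otimes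 L}$ satisfies $t(u)\Psi_{+,o}=t(-u)\Psi_{+,o}$. -/

import Mathlib

namespace XYZ

open Matrix

noncomputable section

/-! ### Jacobi theta functions, with `q = exp (π i τ)` -/

/-- `θ₁(u|τ) = -i ∑ₖ (-1)ᵏ q^((k+1/2)²) e^(iπ(2k+1)u)`. -/
def theta1 (τ u : ℂ) : ℂ :=
  -Complex.I * ∑' k : ℤ, (-1 : ℂ) ^ k * Complex.exp (Real.pi * Complex.I * τ * (k + 1 / 2) ^ 2)
    * Complex.exp (Real.pi * Complex.I * (2 * k + 1) * u)

/-- `θ₂(u|τ) = ∑ₖ q^((k+1/2)²) e^(iπ(2k+1)u)`. -/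
def theta2 (τ u : ℂ) : ℂ :=
  ∑' k : ℤ, Complex.exp (Real.pi * Complex.I * τ * (k + 1 / 2) ^ 2)
    * Complex.exp (Real.pi * Complex.I * (2 * k + 1) * u)

/-- `θ₃(u|τ) = ∑ₖ q^(k²) e^(2iπku)`. -/
def theta3 (τ u : ℂ) : ℂ :=
  ∑' k : ℤ, Complex.exp (Real.pi * Complex.I * τ * k ^ 2)
    * Complex.exp (2 * Real.pi * Complex.I * k * u)

/-- `θ₄(u|τ) = ∑ₖ (-1)ᵏ q^(k²) e^(2iπku)`. -/
def theta4 (τ u : ℂ) : ℂ :=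
  ∑' k : ℤ, (-1 : ℂ) ^ k * Complex.exp (Real.pi * Complex.I * τ * k ^ 2)
    * Complex.exp (2 * Real.pi * Complex.I * k * u)

/-- `k_i = θ_{5-i}` for `i = 1, 2, 3, 4`; the index runs over `0, 1, 2, 3` here. -/
def kFun (τ : ℂ) (i : Fin 4) (u : ℂ) : ℂ :=
  ![theta4 τ u, theta3 τ u, theta2 τ u, theta1 τ u] i

/-! ### Pauli matrices, Lax operators, transfer matrix -/

/-- `σˣ, σʸ, σᶻ, 𝕀` for the indices `0, 1, 2, 3`. -/
def sigma : Fin 4 → Matrix (Fin 2) (Fin 2) ℂ :=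
  ![!![0, 1; 1, 0], !![0, -Complex.I; Complex.I, 0], !![1, 0; 0, -1], 1]

/-- The Pauli matrix `σ^α`, `α = x, y, z` being the indices `0, 1, 2`. -/
def pauli (α : Fin 3) : Matrix (Fin 2) (Fin 2) ℂ := sigma α.castSucc

/-- Weights `w_i(u) = θ_{5-i}(u + η/2) / (2 θ_{5-i}(η/2))` of the `R`-matrix
`R(u) = ∑ᵢ w_i(u) σ^i ⊗ σ^i`. -/
def weight (τ η : ℂ) (i : Fin 4) (u : ℂ) : ℂ :=
  kFun τ i (u + η / 2) / (2 * kFun τ i (η / 2))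

/-- Vectors of `(ℂ²)^{⊗L}`, by their coordinates in the product basis. -/
abbrev State (L : ℕ) := (Fin L → Fin 2) → ℂ

/-- Operators on `(ℂ²)^{⊗L}`, by their matrices in the product basis. -/
abbrev Op (L : ℕ) := Matrix (Fin L → Fin 2) (Fin L → Fin 2) ℂ

/-- The one-site operator `A_j = 1 ⊗ ⋯ ⊗ A ⊗ ⋯ ⊗ 1`, with `A` in the `j`-th factor. -/
def siteOp {L : ℕ} (A : Matrix (Fin 2) (Fin 2) ℂ) (j : Fin L) : Op L :=
  fun s s' => A (s j) (s' j) * if ∀ k, k ≠ j → s k = s' k then 1 else 0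

/-- `R_{0,j}(u) = ∑ᵢ w_i(u) σ^i_0 σ^i_j`, as a `2 × 2` matrix (over the auxiliary space `0`) of
operators on the chain. -/
def rMatrix (τ η : ℂ) {L : ℕ} (j : Fin L) (u : ℂ) : Matrix (Fin 2) (Fin 2) (Op L) :=
  fun p q => ∑ i : Fin 4, (weight τ η i u * sigma i p q) • siteOp (sigma i) j

/-- The Lax operator `ℒ_{0,j}(u) = R_{0,j}(u - η/2)`. -/
def lax (τ η : ℂ) {L : ℕ} (j : Fin L) (u : ℂ) : Matrix (Fin 2) (Fin 2) (Op L) :=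
  rMatrix τ η j (u - η / 2)

/-- The twisted monodromy matrix `T_0(u) = G_0 ℒ_{0,L}(u) ⋯ ℒ_{0,1}(u)`. -/
def monodromy (τ η : ℂ) (L : ℕ) (G : Matrix (Fin 2) (Fin 2) ℂ) (u : ℂ) :
    Matrix (Fin 2) (Fin 2) (Op L) :=
  G.map (algebraMap ℂ (Op L)) * (List.ofFn fun j : Fin L => lax τ η j u).reverse.prod

/-- The transfer matrix `t(u) = Tr_0 T_0(u)`. -/
def transfer (τ η : ℂ) (L : ℕ) (G : Matrix (Fin 2) (Fin 2) ℂ) (u : ℂ) : Op L :=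
  (monodromy τ η L G u).trace

/-- `t(u) Ψ = ε t(-u) Ψ` for all `u`. -/
def IsBoundaryState (τ η : ℂ) {L : ℕ} (G : Matrix (Fin 2) (Fin 2) ℂ) (ε : ℂ) (Ψ : State L) :
    Prop :=
  ∀ u : ℂ, transfer τ η L G u *ᵥ Ψ = ε • (transfer τ η L G (-u) *ᵥ Ψ)

/-! ### The `K`-matrix and factorized states -/

/-- `K(u) = (α₁ / k₁(u)) σˣ + (α₂ / k₂(u)) σʸ + (α₃ / k₃(u)) σᶻ + (α₄ / k₄(u)) 𝕀`. -/
def kMatrix (τ : ℂ) (c : Fin 4 → ℂ) (u : ℂ) : Matrix (Fin 2) (Fin 2) ℂ :=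
  ∑ i : Fin 4, (c i / kFun τ i u) • sigma i

/-- Coordinates `[K(η/2) σʸ]_{ij}` of the two-site state obtained from `K`. -/
def kPair (τ η : ℂ) (c : Fin 4 → ℂ) : Matrix (Fin 2) (Fin 2) ℂ :=
  kMatrix τ c (η / 2) * pauli 1

/-- Compatibility `σʸ Kᵗ(-u) σʸ G = ε G σʸ Kᵗ(-u) σʸ` of `K` with the twist, for all `u` at which
`K` is defined. -/
def Compatible (τ : ℂ) (c : Fin 4 → ℂ) (G : Matrix (Fin 2) (Fin 2) ℂ) (ε : ℂ) : Prop :=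
  ∀ u : ℂ, (∀ i, kFun τ i (-u) ≠ 0) →
    pauli 1 * (kMatrix τ c (-u))ᵀ * pauli 1 * G
      = ε • (G * (pauli 1 * (kMatrix τ c (-u))ᵀ * pauli 1))

/-- The product state `v₁ ⊗ ⋯ ⊗ v_L`. -/
def productState {L : ℕ} (v : Fin L → Fin 2 → ℂ) : State L :=
  fun s => ∏ j, v j (s j)

/-- The two-site product state `ψ^{⊗n}` on `2n` sites, with the copies of
`ψ = ∑ ψ_{ij} |i⟩ ⊗ |j⟩` on the sites `(1,2), (3,4), …`. -/
def pairState (n : ℕ) (ψ : Matrix (Fin 2) (Fin 2) ℂ) : State (2 * n) :=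
  fun s => ∏ k : Fin n, ψ (s ⟨2 * k, by omega⟩) (s ⟨2 * k + 1, by omega⟩)

/-- `∏_{n even} σ^α_n` over the sites `n = 1, …, L`; site `n` has index `n - 1` in `Fin L`. -/
def evenSigma (L : ℕ) (α : Fin 3) : Op L :=
  (List.ofFn fun j : Fin L => if Even (j.val + 1) then siteOp (pauli α) j else 1).prod

end

end XYZ

/-!
The argument uses no identity between theta functions beyond parity.  Since `θ₂`, `θ₃`, `θ₄` are
even and `θ₁` is odd, the Lax operator is `ℒ(u) = ∑ᵢ wᵢ σ^i ⊗ σ^i`, and `u ↦ -u` only reverses the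
sign of the coefficient of the identity (`laxWeight_neg`).  Every assertion about `t(u)` and `t(-u)`
then holds for arbitrary complex numbers `wᵢ`.

The coordinates of `t(u) Ψ`, for a product of one-site or two-site vectors `Ψ`, are twisted traces
`Tr (G X_n ⋯ X_1)` of `2 × 2` matrices attached to the sites or to the pairs of sites
(`transfer_mulVec_productState`, `transfer_mulVec_pairState`).  If an invertible matrix `M` satisfies
`M X(u) = ± X(-u) M` for each factor and commutes with `G` up to a sign, cyclicity of the trace gives
the assertion (`intertwine_ofFn_reverse_prod`, `trace_mul_of_intertwine`).

* For the pair state of `K σ^y` with `K = ∑ᵢ κᵢ σ^i` the intertwiner is `∑ᵢ (κᵢ / wᵢ) σ^i`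
  (`pauliSum_mul_pairEntry`), up to a factor the matrix `K(u)`.  It commutes with the twist up to the
  sign `ε` because `K` does.
* For odd length the intertwiner has constant coefficients divided by the `wᵢ`.  With a twist, two
  intertwiners, conjugate under `σ^α`, alternate along the chain (`isBoundaryState_alternating`).

After clearing denominators the intertwiner is polynomial in `w` and `κ`, but it may be singular for
particular values.  Its determinant is not identically zero on the space of admissible parameters,
and both sides of the assertion are continuous, so the singular values follow by density
(`eq_of_eq_on_ne_zero`).
-/

namespace XYZ

open Matrix Filter Topology

noncomputable section

/-! ### Parity of the theta functions -/

theorem theta4_neg (τ u : ℂ) : theta4 τ (-u) = theta4 τ u := by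
  unfold theta4
  rw [← (Equiv.neg ℤ).tsum_eq]
  refine tsum_congr fun k => ?_
  have h : (-1 : ℂ) ^ (-k) = (-1) ^ k := by
    rcases Int.even_or_odd k with hk | hk <;> simp [hk.neg_one_zpow]
  simp [h]

theorem theta3_neg (τ u : ℂ) : theta3 τ (-u) = theta3 τ u := by
  unfold theta3
  rw [← (Equiv.neg ℤ).tsum_eq]
  refine tsum_congr fun k => ?_
  simp

/-- The symmetry of the exponents is `k ↦ -1 - k`; reindexing needs no convergence. -/
theorem theta2_neg (τ u : ℂ) : theta2 τ (-u) = theta2 τ u := by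
  unfold theta2
  rw [← (Equiv.subLeft (-1 : ℤ)).tsum_eq]
  refine tsum_congr fun k => ?_
  simp only [Equiv.subLeft_apply]
  push_cast
  congr 2 <;> ring

theorem theta1_neg (τ u : ℂ) : theta1 τ (-u) = -theta1 τ u := by
  unfold theta1
  rw [← mul_neg, ← tsum_neg, ← (Equiv.subLeft (-1 : ℤ)).tsum_eq]
  congr 1
  refine tsum_congr fun k => ?_
  have h : (-1 : ℂ) ^ (-1 - k) = -(-1) ^ k := by
    rw [zpow_sub₀ (by norm_num)]
    rcases Int.even_or_odd k with hk | hk <;> simp [hk.neg_one_zpow]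
  simp only [Equiv.subLeft_apply, h, neg_mul]
  push_cast
  congr 3 <;> ring_nf

/-- The effect of `u ↦ -u` on the coefficients of the Lax operator. -/
def negLast (w : Fin 4 → ℂ) : Fin 4 → ℂ := ![w 0, w 1, w 2, -w 3]

/-- The coefficients `k_i(u) / (2 k_i(η/2))` of `ℒ(u)` in the basis `σ^i ⊗ σ^i`. -/
def laxWeight (τ η u : ℂ) : Fin 4 → ℂ := fun i => weight τ η i (u - η / 2)

theorem laxWeight_neg (τ η u : ℂ) : laxWeight τ η (-u) = negLast (laxWeight τ η u) := by
  funext i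
  fin_cases i <;>
    simp [laxWeight, weight, negLast, kFun, theta1_neg, theta2_neg, theta3_neg, theta4_neg, neg_div]

/-! ### Matrix elements of the transfer matrix -/

/-- The matrix element `⟨p| ∑ᵢ wᵢ σ^i ⊗ σ^i |q⟩` in the quantum space, an operator on the
auxiliary space. -/
def laxEntry (w : Fin 4 → ℂ) (p q : Fin 2) : Matrix (Fin 2) (Fin 2) ℂ :=
  ∑ i, (w i * sigma i p q) • sigma i

theorem lax_apply (τ η u : ℂ) {L : ℕ} (j : Fin L) (p q : Fin 2) (s s' : Fin L → Fin 2) :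
    lax τ η j u p q s s' =
      laxEntry (laxWeight τ η u) (s j) (s' j) p q * if ∀ k, k ≠ j → s k = s' k then 1 else 0 := by
  simp only [lax, rMatrix, laxEntry, Matrix.sum_apply, Matrix.smul_apply, siteOp, smul_eq_mul,
    laxWeight, Finset.sum_mul]
  refine Finset.sum_congr rfl fun i _ => by ring

theorem update_eq_of_forall_ne {L : ℕ} {s t : Fin L → Fin 2} {j : Fin L}
    (h : ∀ k, k ≠ j → s k = t k) : Function.update s j (t j) = t := by
  funext k
  by_cases hk : k = j
  · subst hk; simp
  · simp [hk, h k hk]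

/-- A sum over configurations that agree with `s` off the site `j` is a sum over the value at
`j`. -/
theorem sum_agree_off {L : ℕ} (s : Fin L → Fin 2) (j : Fin L) (f : (Fin L → Fin 2) → ℂ) :
    (∑ t, (if ∀ k, k ≠ j → s k = t k then (1 : ℂ) else 0) * f t)
      = ∑ x, f (Function.update s j x) := by
  simp only [ite_mul, one_mul, zero_mul]
  rw [← Finset.sum_filter]
  refine Finset.sum_bij' (fun t _ => t j) (fun x _ => Function.update s j x) ?_ ?_ ?_ ?_ ?_
  · simp
  · intro x _
    simp only [Finset.mem_filter, Finset.mem_univ, true_and]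
    intro k hk
    simp [hk]
  · intro t ht
    exact update_eq_of_forall_ne (by simpa using ht)
  · simp
  · intro t ht
    rw [update_eq_of_forall_ne (by simpa using ht)]

/-- Matrix elements of a product of Lax operators over distinct sites: they factorize into a
product of auxiliary-space matrices, one for each site of the list. -/
theorem lax_prod_apply (τ η u : ℂ) {L : ℕ} (l : List (Fin L)) (hl : l.Nodup) (p q : Fin 2)
    (s s' : Fin L → Fin 2) :
    (l.map fun j => lax τ η j u).prod p q s s' =
      (l.map fun j => laxEntry (laxWeight τ η u) (s j) (s' j)).prod p q *
        if ∀ k, k ∉ l → s k = s' k then 1 else 0 := by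
  induction l generalizing p q s with
  | nil =>
    by_cases hs : s = s'
    · subst hs
      by_cases hpq : p = q <;> simp [hpq]
    · have : ¬ ∀ k, s k = s' k := fun h => hs (funext h)
      by_cases hpq : p = q <;> simp [hpq, hs, this]
  | cons j l ih =>
    obtain ⟨hj, hl⟩ := List.nodup_cons.1 hl
    simp only [List.map_cons, List.prod_cons, Matrix.mul_apply, Matrix.sum_apply]
    rw [Finset.sum_mul]
    refine Finset.sum_congr rfl fun r _ => ?_
    simp only [lax_apply]
    have h1 : ∀ t : Fin L → Fin 2,
        laxEntry (laxWeight τ η u) (s j) (t j) p r *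
            (if ∀ k, k ≠ j → s k = t k then 1 else 0) *
            (l.map fun j => lax τ η j u).prod r q t s' =
          (if ∀ k, k ≠ j → s k = t k then 1 else 0) *
            (laxEntry (laxWeight τ η u) (s j) (t j) p r *
              (l.map fun j => lax τ η j u).prod r q t s') := fun t => by ring
    rw [Finset.sum_congr rfl fun t _ => h1 t, sum_agree_off, Finset.sum_eq_single (s' j)]
    · rw [ih hl]
      have h2 : (l.map fun k => laxEntry (laxWeight τ η u) (Function.update s j (s' j) k) (s' k)) =
          l.map fun k => laxEntry (laxWeight τ η u) (s k) (s' k) := by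
        refine List.map_congr_left fun k hk => ?_
        rw [Function.update_of_ne (fun h => hj (by rwa [← h]))]
      have h3 : (∀ k, k ∉ l → Function.update s j (s' j) k = s' k) ↔
          ∀ k, k ∉ j :: l → s k = s' k := by
        refine forall_congr' fun k => ?_
        by_cases hk : k = j
        · subst hk; simp
        · simp [hk]
      rw [h2, if_congr h3 rfl rfl, Function.update_self]
      ring
    · -- The site `j` does not occur again in the list, so its value must already be `s' j`.
      intro x _ hx
      rw [ih hl, if_neg]
      · ring
      · intro h
        exact hx (by simpa using h j hj)
    · simp

/-- Matrix elements of the transfer matrix: between basis configurations it is the twisted trace of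
an ordered product of `2 × 2` matrices. -/
theorem transfer_apply (τ η u : ℂ) (L : ℕ) (G : Matrix (Fin 2) (Fin 2) ℂ) (s s' : Fin L → Fin 2) :
    transfer τ η L G u s s' =
      (G * (List.ofFn fun j => laxEntry (laxWeight τ η u) (s j) (s' j)).reverse.prod).trace := by
  have h : ∀ p q, (List.ofFn fun j : Fin L => lax τ η j u).reverse.prod p q s s' =
      (List.ofFn fun j => laxEntry (laxWeight τ η u) (s j) (s' j)).reverse.prod p q := by
    intro p q
    rw [List.ofFn_eq_map, List.ofFn_eq_map, ← List.map_reverse, ← List.map_reverse,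
      lax_prod_apply _ _ _ _ (List.nodup_reverse.2 (List.nodup_finRange L)), if_pos (by simp),
      mul_one]
  simp only [transfer, monodromy, Matrix.trace, Matrix.diag_apply, Matrix.mul_apply,
    Matrix.sum_apply, Matrix.map_apply, Algebra.algebraMap_eq_smul_one, ← h]
  refine Finset.sum_congr rfl fun p _ => Finset.sum_congr rfl fun q _ => ?_
  simp [Matrix.one_apply]

/-- Distributivity of an ordered product of sums. -/
theorem sum_ofFn_reverse_prod {R X : Type*} [Semiring R] [Fintype X] (n : ℕ)
    (g : Fin n → X → R) :
    ∑ f : Fin n → X, (List.ofFn fun j => g j (f j)).reverse.prod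
      = (List.ofFn fun j => ∑ x, g j x).reverse.prod := by
  induction n with
  | zero => simp
  | succ n ih =>
    rw [← (Fin.consEquiv fun _ => X).sum_comp, Fintype.sum_prod_type]
    simp only [List.ofFn_succ, List.reverse_cons, List.prod_append, Fin.consEquiv_apply,
      Fin.cons_zero, Fin.cons_succ, List.prod_cons, List.prod_nil, mul_one]
    simp_rw [← Finset.sum_mul, ih, ← Finset.mul_sum]

/-! ### Action on product states and pair states -/

/-- The vector `∑ᵢ wᵢ σ^i ⊗ σ^i v`, as an auxiliary-space matrix depending on the coordinate `p`
of the quantum space. -/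
def siteEntry (w : Fin 4 → ℂ) (v : Fin 2 → ℂ) (p : Fin 2) : Matrix (Fin 2) (Fin 2) ℂ :=
  ∑ x, v x • laxEntry w p x

/-- The action of two neighbouring Lax operators on the two-site vector `P`, as an auxiliary-space
matrix depending on the coordinates `p`, `q` of the quantum spaces. -/
def pairEntry (w : Fin 4 → ℂ) (P : Matrix (Fin 2) (Fin 2) ℂ) (p q : Fin 2) :
    Matrix (Fin 2) (Fin 2) ℂ :=
  ∑ x : Fin 2 × Fin 2, P x.1 x.2 • (laxEntry w q x.2 * laxEntry w p x.1)

theorem prod_smul_ofFn_reverse {n : ℕ} (c : Fin n → ℂ) (A : Fin n → Matrix (Fin 2) (Fin 2) ℂ) :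
    (List.ofFn fun j => c j • A j).reverse.prod = (∏ j, c j) • (List.ofFn A).reverse.prod := by
  induction n with
  | zero => simp
  | succ n ih =>
    simp only [List.ofFn_succ, List.reverse_cons, List.prod_append, List.prod_cons, List.prod_nil,
      mul_one, ih, Fin.prod_univ_succ]
    rw [smul_mul_smul_comm, mul_comm]

theorem ofFn_two_mul_reverse_prod {R : Type*} [Monoid R] (n : ℕ) (h : Fin (2 * n) → R) :
    (List.ofFn h).reverse.prod =
      (List.ofFn fun k : Fin n =>
        h ⟨2 * k + 1, by omega⟩ * h ⟨2 * k, by omega⟩).reverse.prod := by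
  induction n with
  | zero => rfl
  | succ n ih =>
    have h2 : List.ofFn h = List.ofFn fun j : Fin (2 * n + 1 + 1) => h j := rfl
    rw [h2, List.ofFn_succ, List.ofFn_succ, List.ofFn_succ]
    simp only [List.reverse_cons, List.prod_append, List.prod_cons, List.prod_nil, mul_one]
    rw [ih fun j => h j.succ.succ, mul_assoc]
    rfl

/-- Configurations of `2n` sites as configurations of `n` pairs of sites. -/
def pairEquiv (n : ℕ) : (Fin n → Fin 2 × Fin 2) ≃ (Fin (2 * n) → Fin 2) where
  toFun f j := if j.val % 2 = 0 then (f ⟨j / 2, by omega⟩).1 else (f ⟨j / 2, by omega⟩).2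
  invFun s k := (s ⟨2 * k, by omega⟩, s ⟨2 * k + 1, by omega⟩)
  left_inv f := by
    funext k
    have h1 : (2 * (k : ℕ) + 1) / 2 = k := by omega
    simp [h1]
  right_inv s := by
    funext j
    by_cases hj : j.val % 2 = 0
    · simp only [hj, if_true]
      congr 1; ext; simp; omega
    · simp only [hj, if_false]
      congr 1; ext; simp; omega

theorem transfer_mulVec_productState (τ η u : ℂ) (L : ℕ) (G : Matrix (Fin 2) (Fin 2) ℂ)
    (v : Fin L → Fin 2 → ℂ) (s : Fin L → Fin 2) :
    (transfer τ η L G u *ᵥ productState v) s =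
      (G * (List.ofFn fun j => siteEntry (laxWeight τ η u) (v j) (s j)).reverse.prod).trace := by
  simp only [siteEntry, Matrix.mulVec, dotProduct]
  rw [← sum_ofFn_reverse_prod L
    (fun j x => v j x • laxEntry (laxWeight τ η u) (s j) x), Matrix.mul_sum, Matrix.trace_sum]
  refine Finset.sum_congr rfl fun t _ => ?_
  rw [prod_smul_ofFn_reverse (fun j => v j (t j)), Matrix.mul_smul,
    Matrix.trace_smul, smul_eq_mul, mul_comm, ← transfer_apply]
  rfl

theorem transfer_mulVec_pairState (τ η u : ℂ) (n : ℕ) (G P : Matrix (Fin 2) (Fin 2) ℂ)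
    (s : Fin (2 * n) → Fin 2) :
    (transfer τ η (2 * n) G u *ᵥ pairState n P) s =
      (G * (List.ofFn fun k : Fin n => pairEntry (laxWeight τ η u) P
        (s ⟨2 * k, by omega⟩) (s ⟨2 * k + 1, by omega⟩)).reverse.prod).trace := by
  simp only [pairEntry, Matrix.mulVec, dotProduct]
  rw [← sum_ofFn_reverse_prod n (fun k (x : Fin 2 × Fin 2) => (P x.1 x.2 •
    (laxEntry (laxWeight τ η u) (s ⟨2 * k + 1, by omega⟩) x.2 *
      laxEntry (laxWeight τ η u) (s ⟨2 * k, by omega⟩) x.1) : Matrix (Fin 2) (Fin 2) ℂ)),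
    Matrix.mul_sum, Matrix.trace_sum, ← (pairEquiv n).symm.sum_comp]
  refine Finset.sum_congr rfl fun t _ => ?_
  rw [prod_smul_ofFn_reverse (fun k => P ((pairEquiv n).symm t k).1 ((pairEquiv n).symm t k).2),
    Matrix.mul_smul, Matrix.trace_smul, smul_eq_mul, mul_comm, transfer_apply,
    ofFn_two_mul_reverse_prod]
  rfl

/-- A one-site operator acts on a product state by acting on one factor. -/
theorem siteOp_mulVec_productState {L : ℕ} (A : Matrix (Fin 2) (Fin 2) ℂ) (j : Fin L)
    (v : Fin L → Fin 2 → ℂ) :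
    siteOp A j *ᵥ productState v = productState (Function.update v j (A *ᵥ v j)) := by
  funext s
  have h : ∀ t : Fin L → Fin 2, siteOp A j s t * productState v t =
      (if ∀ k, k ≠ j → s k = t k then 1 else 0) * (A (s j) (t j) * productState v t) :=
    fun t => by rw [siteOp]; ring
  simp only [Matrix.mulVec, dotProduct]
  rw [Finset.sum_congr rfl fun t _ => h t, sum_agree_off]
  simp only [productState, Function.update_self]
  simp_rw [Fintype.prod_eq_mul_prod_compl j]
  simp only [Function.update_self]
  rw [show (A *ᵥ v j) (s j) = ∑ x, A (s j) x * v j x from rfl, Finset.sum_mul]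
  refine Finset.sum_congr rfl fun x _ => ?_
  rw [← mul_assoc]
  congr 1
  refine Finset.prod_congr rfl fun k hk => ?_
  have hk : k ≠ j := by simpa using hk
  simp [hk]

theorem evenSigma_mulVec_productState (L : ℕ) (α : Fin 3) (v : Fin 2 → ℂ) :
    evenSigma L α *ᵥ productState (fun _ : Fin L => v) =
      productState fun j => if Even (j.val + 1) then pauli α *ᵥ v else v := by
  have h : ∀ l : List (Fin L), l.Nodup →
      (l.map fun j : Fin L => if Even (j.val + 1) then siteOp (pauli α) j else 1).prod *ᵥ
        productState (fun _ : Fin L => v) =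
      productState fun j => if j ∈ l ∧ Even (j.val + 1) then pauli α *ᵥ v else v := by
    intro l hl
    induction l with
    | nil => simp
    | cons j l ih =>
      obtain ⟨hj, hl⟩ := List.nodup_cons.1 hl
      rw [List.map_cons, List.prod_cons, ← Matrix.mulVec_mulVec, ih hl]
      split_ifs with hp
      · rw [siteOp_mulVec_productState]
        congr 1
        funext k
        by_cases hk : k = j
        · subst hk; simp [hj, hp]
        · simp [hk]
      · rw [Matrix.one_mulVec]
        congr 1
        funext k
        by_cases hk : k = j
        · subst hk; simp [hp]
        · simp [hk]
  rw [evenSigma, List.ofFn_eq_map, h _ (List.nodup_finRange L)]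
  simp

/-! ### Intertwining relations -/

theorem sigma_zero : sigma 0 = !![0, 1; 1, 0] := rfl

theorem sigma_one : sigma 1 = !![0, -Complex.I; Complex.I, 0] := rfl

theorem sigma_two : sigma 2 = !![1, 0; 0, -1] := rfl

theorem sigma_three : sigma 3 = !![1, 0; 0, 1] := Matrix.one_fin_two

theorem laxEntry_zero_zero (w : Fin 4 → ℂ) :
    laxEntry w 0 0 = !![w 3 + w 2, 0; 0, w 3 - w 2] := by
  ext i j
  fin_cases i <;> fin_cases j <;>
    simp [laxEntry, sigma_zero, sigma_one, sigma_two, sigma_three, Fin.sum_univ_four] <;> ring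

theorem laxEntry_one_one (w : Fin 4 → ℂ) :
    laxEntry w 1 1 = !![w 3 - w 2, 0; 0, w 3 + w 2] := by
  ext i j
  fin_cases i <;> fin_cases j <;>
    simp [laxEntry, sigma_zero, sigma_one, sigma_two, sigma_three, Fin.sum_univ_four] <;> ring

theorem laxEntry_zero_one (w : Fin 4 → ℂ) :
    laxEntry w 0 1 = !![0, w 0 - w 1; w 0 + w 1, 0] := by
  ext i j
  fin_cases i <;> fin_cases j <;>
    simp [laxEntry, sigma_zero, sigma_one, sigma_two, sigma_three, Fin.sum_univ_four]
  · linear_combination w 1 * Complex.I_mul_I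
  · linear_combination -w 1 * Complex.I_mul_I

theorem laxEntry_one_zero (w : Fin 4 → ℂ) :
    laxEntry w 1 0 = !![0, w 0 + w 1; w 0 - w 1, 0] := by
  ext i j
  fin_cases i <;> fin_cases j <;>
    simp [laxEntry, sigma_zero, sigma_one, sigma_two, sigma_three, Fin.sum_univ_four]
  · linear_combination -w 1 * Complex.I_mul_I
  · linear_combination w 1 * Complex.I_mul_I

theorem siteEntry_zero (w : Fin 4 → ℂ) (a b : ℂ) :
    siteEntry w ![a, b] 0 =
      !![a * (w 3 + w 2), b * (w 0 - w 1); b * (w 0 + w 1), a * (w 3 - w 2)] := by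
  simp [siteEntry, laxEntry_zero_zero, laxEntry_zero_one, Fin.sum_univ_two, Matrix.smul_of]

theorem siteEntry_one (w : Fin 4 → ℂ) (a b : ℂ) :
    siteEntry w ![a, b] 1 =
      !![b * (w 3 - w 2), a * (w 0 + w 1); a * (w 0 - w 1), b * (w 3 + w 2)] := by
  simp [siteEntry, laxEntry_one_zero, laxEntry_one_one, Fin.sum_univ_two, Matrix.smul_of]

/-- `K = ∑ᵢ κᵢ σ^i`. -/
def pauliSum (κ : Fin 4 → ℂ) : Matrix (Fin 2) (Fin 2) ℂ := ∑ i, κ i • sigma i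

/-- The product `∏_{j ≠ i} wⱼ`. -/
def coprod (w : Fin 4 → ℂ) : Fin 4 → ℂ :=
  ![w 1 * w 2 * w 3, w 0 * w 2 * w 3, w 0 * w 1 * w 3, w 0 * w 1 * w 2]

theorem pauliSum_eq (κ : Fin 4 → ℂ) :
    pauliSum κ = !![κ 3 + κ 2, κ 0 - Complex.I * κ 1; κ 0 + Complex.I * κ 1, κ 3 - κ 2] := by
  ext i j
  fin_cases i <;> fin_cases j <;>
    simp [pauliSum, sigma, Fin.sum_univ_four, Matrix.add_apply] <;> ring

/-- The matrix `∑ᵢ (κᵢ / wᵢ) σ^i`, with denominators cleared, carries the action of two Lax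
operators on the two-site vector `K σ^y` at `u` to the one at `-u`. -/
theorem pauliSum_mul_pairEntry (w κ : Fin 4 → ℂ) (p q : Fin 2) :
    pauliSum (κ * coprod w) * pairEntry w (pauliSum κ * pauli 1) p q =
      pairEntry (negLast w) (pauliSum κ * pauli 1) p q * pauliSum (κ * coprod w) := by
  -- With an overall factor `i` split off, `i` occurs only through `i κ 1`, so the entries below are
  -- polynomial identities that do not use `i² = -1`.
  have hP : pauliSum κ * pauli 1 = Complex.I •
      !![κ 0 - Complex.I * κ 1, -(κ 3 + κ 2); κ 3 - κ 2, -(κ 0 + Complex.I * κ 1)] := by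
    rw [pauliSum_eq]
    ext i j
    fin_cases i <;> fin_cases j <;>
      simp [pauli, sigma, Matrix.mul_apply, Fin.sum_univ_two] <;> ring
  have hB : ∀ w' : Fin 4 → ℂ, pairEntry w' (Complex.I •
      !![κ 0 - Complex.I * κ 1, -(κ 3 + κ 2); κ 3 - κ 2, -(κ 0 + Complex.I * κ 1)]) p q =
      Complex.I • pairEntry w'
      !![κ 0 - Complex.I * κ 1, -(κ 3 + κ 2); κ 3 - κ 2, -(κ 0 + Complex.I * κ 1)] p q := by
    intro w'
    simp only [pairEntry, Matrix.smul_apply, smul_assoc, Finset.smul_sum]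
  rw [hP, hB, hB, pauliSum_eq, Matrix.mul_smul, Matrix.smul_mul]
  congr 1
  have hsum : ∀ (w' : Fin 4 → ℂ) (a b c d : ℂ), pairEntry w' !![a, b; c, d] p q =
      a • (laxEntry w' q 0 * laxEntry w' p 0) + b • (laxEntry w' q 1 * laxEntry w' p 0) +
        (c • (laxEntry w' q 0 * laxEntry w' p 1) + d • (laxEntry w' q 1 * laxEntry w' p 1)) := by
    intro w' a b c d
    simp [pairEntry, Fintype.sum_prod_type, Fin.sum_univ_two]
  have hf : negLast w 0 = w 0 ∧ negLast w 1 = w 1 ∧ negLast w 2 = w 2 ∧ negLast w 3 = -w 3 :=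
    ⟨rfl, rfl, rfl, rfl⟩
  have hc : coprod w 0 = w 1 * w 2 * w 3 ∧ coprod w 1 = w 0 * w 2 * w 3 ∧
      coprod w 2 = w 0 * w 1 * w 3 ∧ coprod w 3 = w 0 * w 1 * w 2 := ⟨rfl, rfl, rfl, rfl⟩
  rw [hsum, hsum]
  simp only [Pi.mul_apply, hc]
  generalize negLast w = w' at *
  obtain ⟨h0, h1, h2, h3⟩ := hf
  clear hsum hB
  revert p q
  simp only [Fin.forall_fin_two, laxEntry_zero_zero, laxEntry_zero_one, laxEntry_one_zero,
    laxEntry_one_one, h0, h1, h2, h3, Matrix.mul_fin_two, Matrix.smul_of, Matrix.smul_cons,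
    Matrix.smul_empty, Matrix.of_add_of, Matrix.add_cons, Matrix.head_cons, Matrix.tail_cons,
    Matrix.empty_add_empty, smul_eq_mul]
  refine ⟨⟨?_, ?_⟩, ?_, ?_⟩
  all_goals
    refine congrArg Matrix.of ?_
    simp only [Matrix.vecCons_inj, and_true]
    refine ⟨⟨?_, ?_⟩, ?_, ?_⟩ <;> ring

theorem pauliSum_det (κ : Fin 4 → ℂ) :
    (pauliSum κ).det = κ 3 ^ 2 - κ 2 ^ 2 - κ 0 ^ 2 - κ 1 ^ 2 := by
  rw [pauliSum_eq, Matrix.det_fin_two_of]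
  linear_combination κ 1 ^ 2 * Complex.I_mul_I

/-! ### From intertwiners to twisted traces -/

/-- If `M_{j+1} A_j = c B_j M_j` for all sites `j`, then `M` passes through the ordered product. -/
theorem intertwine_ofFn_reverse_prod {R : Type*} [Ring R] [Algebra ℂ R] (c : ℂ) (n : ℕ)
    (M : ℕ → R) (A B : Fin n → R) (h : ∀ j : Fin n, M (j + 1) * A j = c • (B j * M j)) :
    M n * (List.ofFn A).reverse.prod = c ^ n • ((List.ofFn B).reverse.prod * M 0) := by
  induction n with
  | zero => simp
  | succ n ih =>
    rw [List.ofFn_succ', List.ofFn_succ', List.concat_eq_append, List.concat_eq_append,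
      List.reverse_append, List.reverse_append, List.prod_append, List.prod_append]
    have h1 := ih (fun j => A j.castSucc) (fun j => B j.castSucc) fun j => h j.castSucc
    have h2 := h (Fin.last n)
    rw [Fin.val_last] at h2
    simp only [List.reverse_cons, List.reverse_nil, List.nil_append, List.prod_cons,
      List.prod_nil, mul_one]
    rw [← mul_assoc, h2, smul_mul_assoc, mul_assoc, h1, mul_smul_comm, smul_smul, pow_succ',
      mul_assoc]

/-- An identity between continuous functions that holds where an entire function `D` does not vanish
holds everywhere, provided `D` does not vanish identically: restrict to a complex line through a
point where `D ≠ 0`. -/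
theorem eq_of_eq_on_ne_zero {E F : Type*} [NormedAddCommGroup E] [NormedSpace ℂ E]
    [TopologicalSpace F] [T2Space F] {D : E → ℂ} (hD : Differentiable ℂ D) {f g : E → F}
    (hf : Continuous f) (hg : Continuous g) (y : E) (hy : D y ≠ 0)
    (h : ∀ x, D x ≠ 0 → f x = g x) (x : E) : f x = g x := by
  let ℓ : ℂ → E := fun t => x + t • (y - x)
  have hℓ : Differentiable ℂ ℓ := by fun_prop
  have han : AnalyticOnNhd ℂ (fun t => D (ℓ t)) Set.univ :=
    (hD.comp hℓ).differentiableOn.analyticOnNhd isOpen_univ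
  have hne : ∀ᶠ t in 𝓝[≠] (0 : ℂ), D (ℓ t) ≠ 0 := by
    by_contra hcon
    have h0 := han.eqOn_zero_of_preconnected_of_frequently_eq_zero isPreconnected_univ
      (Set.mem_univ 0) hcon
    exact hy (by simpa [ℓ] using h0 (Set.mem_univ 1))
  have hf0 : Tendsto (fun t => f (ℓ t)) (𝓝[≠] 0) (𝓝 (f (ℓ 0))) :=
    ((hf.comp hℓ.continuous).tendsto 0).mono_left nhdsWithin_le_nhds
  have hg0 : Tendsto (fun t => g (ℓ t)) (𝓝[≠] 0) (𝓝 (g (ℓ 0))) :=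
    ((hg.comp hℓ.continuous).tendsto 0).mono_left nhdsWithin_le_nhds
  have := tendsto_nhds_unique (hf0.congr' (hne.mono fun t ht => h _ ht)) hg0
  simpa [ℓ] using this

/-- Conjugation by an invertible matrix that commutes with the twist up to the factor `e` changes
the twisted trace by the factor `e`. -/
theorem trace_mul_of_intertwine {G M N T T' : Matrix (Fin 2) (Fin 2) ℂ} {c e : ℂ}
    (hM : M.det ≠ 0) (hT : M * T = c • (T' * N)) (hG : N * G = e • (G * M)) :
    (G * T).trace = c * e * (G * T').trace := by
  have hu : IsUnit M.det := isUnit_iff_ne_zero.2 hM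
  have h1 : T = c • (M⁻¹ * (T' * N)) := by
    rw [← Matrix.mul_smul, ← hT, Matrix.nonsing_inv_mul_cancel_left _ _ hu]
  rw [h1, Matrix.mul_smul, Matrix.trace_smul, ← Matrix.mul_assoc, ← Matrix.mul_assoc,
    Matrix.trace_mul_comm, ← Matrix.mul_assoc, ← Matrix.mul_assoc, hG, Matrix.smul_mul,
    Matrix.smul_mul, Matrix.trace_smul, Matrix.mul_nonsing_inv_cancel_right _ _ hu, smul_eq_mul,
    smul_eq_mul, mul_assoc]

/-! ### Even length -/

theorem continuous_laxEntry (p q : Fin 2) : Continuous fun w => laxEntry w p q := by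
  unfold laxEntry
  fun_prop

theorem continuous_siteEntry (v : Fin 2 → ℂ) (p : Fin 2) :
    Continuous fun w => siteEntry w v p := by
  unfold siteEntry laxEntry
  fun_prop

theorem continuous_pairEntry (p q : Fin 2) :
    Continuous fun x : (Fin 4 → ℂ) × Matrix (Fin 2) (Fin 2) ℂ => pairEntry x.1 x.2 p q := by
  refine continuous_finsetSum _ fun x _ => ?_
  exact (continuous_snd.matrix_elem _ _).smul
    (((continuous_laxEntry _ _).comp continuous_fst).mul
      ((continuous_laxEntry _ _).comp continuous_fst))

theorem continuous_negLast : Continuous negLast := by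
  refine continuous_pi fun i => ?_
  fin_cases i <;> simp [negLast] <;> fun_prop

theorem continuous_trace_ofFn {E : Type*} [TopologicalSpace E] (G : Matrix (Fin 2) (Fin 2) ℂ)
    {n : ℕ} {A : E → Fin n → Matrix (Fin 2) (Fin 2) ℂ} (hA : ∀ j, Continuous fun x => A x j) :
    Continuous fun x => (G * (List.ofFn (A x)).reverse.prod).trace := by
  simp only [List.ofFn_eq_map, ← List.map_reverse]
  exact (continuous_const.mul (continuous_list_prod _ fun j _ => hA j)).matrix_trace

/-- The states built from `K = ∑ᵢ κᵢ σ^i`, when each `σ^i` occurring in `K` commutes with the twist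
up to the sign `ε`. -/
theorem isBoundaryState_pairState (τ η : ℂ) (n : ℕ) (κ : Fin 4 → ℂ)
    (G : Matrix (Fin 2) (Fin 2) ℂ) (ε : ℂ)
    (hκ : ∀ i, κ i = 0 ∨ sigma i * G = ε • (G * sigma i))
    (hex : ∃ i, sigma i * G = ε • (G * sigma i)) :
    IsBoundaryState τ η G ε (pairState n (pauliSum κ * pauli 1)) := by
  classical
  intro u
  funext s
  rw [Pi.smul_apply, transfer_mulVec_pairState, transfer_mulVec_pairState, laxWeight_neg,
    smul_eq_mul]
  generalize laxWeight τ η u = w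
  -- The mask `χ` keeps the perturbed `K` inside the space of matrices compatible with the twist.
  let χ : Fin 4 → ℂ := fun i => if sigma i * G = ε • (G * sigma i) then 1 else 0
  have hχκ : χ * κ = κ := by
    funext i
    rcases hκ i with h | h <;> simp [χ, h]
  have hcont : Continuous fun x : (Fin 4 → ℂ) × (Fin 4 → ℂ) => pauliSum (χ * x.2) * pauli 1 := by
    unfold pauliSum
    simp only [Pi.mul_apply]
    fun_prop
  have key := eq_of_eq_on_ne_zero (E := (Fin 4 → ℂ) × (Fin 4 → ℂ))
    (D := fun x => (pauliSum (χ * x.2 * coprod x.1)).det)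
    (f := fun x => (G * (List.ofFn fun k : Fin n => pairEntry x.1 (pauliSum (χ * x.2) * pauli 1)
        (s ⟨2 * k, by omega⟩) (s ⟨2 * k + 1, by omega⟩)).reverse.prod).trace)
    (g := fun x => ε * (G * (List.ofFn fun k : Fin n =>
        pairEntry (negLast x.1) (pauliSum (χ * x.2) * pauli 1)
        (s ⟨2 * k, by omega⟩) (s ⟨2 * k + 1, by omega⟩)).reverse.prod).trace)
    ?_ ?_ ?_ ?_ ?_ ?_ (w, κ)
  · simpa only [hχκ] using key
  · simp only [pauliSum_det, Pi.mul_apply, coprod, Matrix.cons_val]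
    fun_prop
  · exact continuous_trace_ofFn _ fun j =>
      (continuous_pairEntry _ _).comp (continuous_fst.prodMk hcont)
  · exact continuous_const.mul (continuous_trace_ofFn _ fun j =>
      (continuous_pairEntry _ _).comp ((continuous_negLast.comp continuous_fst).prodMk hcont))
  · exact (1, Pi.single hex.choose 1)
  · have h := hex.choose_spec
    generalize hex.choose = i at h
    have hχ : χ i = 1 := by simp [χ, h]
    rw [pauliSum_det]
    fin_cases i <;> simp_all [coprod]
  · rintro ⟨w, κ⟩ hD
    have hT := intertwine_ofFn_reverse_prod 1 n (fun _ => pauliSum (χ * κ * coprod w))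
      (fun k : Fin n => pairEntry w (pauliSum (χ * κ) * pauli 1)
        (s ⟨2 * k, by omega⟩) (s ⟨2 * k + 1, by omega⟩))
      (fun k : Fin n => pairEntry (negLast w) (pauliSum (χ * κ) * pauli 1)
        (s ⟨2 * k, by omega⟩) (s ⟨2 * k + 1, by omega⟩))
      fun k => by rw [one_smul, pauliSum_mul_pairEntry]
    have hG : pauliSum (χ * κ * coprod w) * G = ε • (G * pauliSum (χ * κ * coprod w)) := by
      simp only [pauliSum, Matrix.mul_sum, Matrix.sum_mul, Finset.smul_sum]
      refine Finset.sum_congr rfl fun i _ => ?_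
      by_cases hi : sigma i * G = ε • (G * sigma i)
      · rw [Matrix.smul_mul, hi, Matrix.mul_smul, smul_comm]
      · simp [χ, hi]
    have := trace_mul_of_intertwine hD hT hG
    simpa using this

/-! ### Odd length -/

/-- The passage from an intertwiner to a boundary state on `2n + 1` sites.  The matrices `M`, `N`
alternate along the chain, and the hypotheses need to be checked only for one site of each
parity. -/
theorem isBoundaryState_alternating (τ η : ℂ) (n : ℕ) (G : Matrix (Fin 2) (Fin 2) ℂ)
    (c ε : ℂ) (v v' : Fin 2 → ℂ) (M N : (Fin 4 → ℂ) → Matrix (Fin 2) (Fin 2) ℂ)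
    (hc : c ^ (2 * n + 1) = ε)
    (hv : ∀ w p, M w * siteEntry w v p = c • (siteEntry (negLast w) v p * N w))
    (hv' : ∀ w p, N w * siteEntry w v' p = c • (siteEntry (negLast w) v' p * M w))
    (hG : ∀ w, N w * G = G * M w)
    (hD : Differentiable ℂ fun w => (M w).det) (hne : ∃ w, (M w).det ≠ 0) :
    IsBoundaryState τ η G ε
      (productState fun j : Fin (2 * n + 1) => if Even (j.val + 1) then v' else v) := by
  intro u
  funext s
  rw [Pi.smul_apply, transfer_mulVec_productState, transfer_mulVec_productState, laxWeight_neg,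
    smul_eq_mul]
  obtain ⟨y, hy⟩ := hne
  refine eq_of_eq_on_ne_zero hD
    (f := fun w => (G * (List.ofFn fun j : Fin (2 * n + 1) =>
      siteEntry w (if Even (j.val + 1) then v' else v) (s j)).reverse.prod).trace)
    (g := fun w => ε * (G * (List.ofFn fun j : Fin (2 * n + 1) =>
      siteEntry (negLast w) (if Even (j.val + 1) then v' else v) (s j)).reverse.prod).trace)
    ?_ ?_ y hy ?_ _
  · exact continuous_trace_ofFn _ fun j => continuous_siteEntry _ _
  · exact continuous_const.mul (continuous_trace_ofFn _ fun j =>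
      (continuous_siteEntry _ _).comp continuous_negLast)
  · intro w hw
    have hT := intertwine_ofFn_reverse_prod c (2 * n + 1) (fun j => if Even j then N w else M w)
      (fun j : Fin (2 * n + 1) => siteEntry w (if Even (j.val + 1) then v' else v) (s j))
      (fun j : Fin (2 * n + 1) => siteEntry (negLast w) (if Even (j.val + 1) then v' else v) (s j))
      fun j => by
        by_cases hj : Even (j : ℕ)
        · simp [hj, Nat.even_add_one, hv]
        · simp [hj, Nat.even_add_one, hv']
    have h1 : ¬ Even (2 * n + 1) := by simp
    simp only [h1, if_false, Even.zero, if_true, hc] at hT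
    simpa using trace_mul_of_intertwine (e := 1) hw hT (by rw [one_smul, hG])

/-- The intertwiner `M = ∑ᵢ mᵢ σ^i` with `i = x, y, z` anticommutes through one site exactly if
`∑ᵢ wᵢ mᵢ σ^i v = 0`; for `v = (1, a)` this makes `wᵢ mᵢ` proportional to
`(1 - a², i (1 + a²), -2a)`. -/
theorem isBoundaryState_odd (τ η : ℂ) (n : ℕ) (a : ℂ) :
    IsBoundaryState τ η 1 (-1) (productState fun _ : Fin (2 * n + 1) => ![1, a]) := by
  let M : (Fin 4 → ℂ) → Matrix (Fin 2) (Fin 2) ℂ := fun w =>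
    !![-2 * a * w 0 * w 1, (1 - a ^ 2) * w 1 * w 2 + (1 + a ^ 2) * w 0 * w 2;
       (1 - a ^ 2) * w 1 * w 2 - (1 + a ^ 2) * w 0 * w 2, 2 * a * w 0 * w 1]
  have hM : ∀ w p,
      M w * siteEntry w ![1, a] p = (-1 : ℂ) • (siteEntry (negLast w) ![1, a] p * M w) := by
    intro w p
    fin_cases p <;> ext i j <;> fin_cases i <;> fin_cases j <;>
      simp [M, siteEntry_zero, siteEntry_one, negLast, Matrix.mul_apply, Fin.sum_univ_two] <;> ring
  have hdet : ∀ w, (M w).det = -(2 * a * w 0 * w 1) ^ 2 -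
      ((1 - a ^ 2) * w 1 * w 2) ^ 2 + ((1 + a ^ 2) * w 0 * w 2) ^ 2 := by
    intro w
    rw [Matrix.det_fin_two_of]
    ring
  have := isBoundaryState_alternating τ η n 1 (-1) (-1) ![1, a] ![1, a] M M
    (by rw [Odd.neg_one_pow ⟨n, rfl⟩]) hM hM (fun w => by simp)
    (by simp only [hdet]; fun_prop) (by
      by_cases ha : a = 0
      · exact ⟨![1, 0, 1, 0], by simp [hdet, ha]⟩
      · exact ⟨![1, 1, 0, 0], by simp [hdet, ha]⟩)
  simpa using this

/-- On a site carrying `v = (1, a)` the matrix `M` turns into `N = σ^x M σ^x`, and on a site carrying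
`σ^x v` back into `M`.  With `N` a combination of `1`, `σ^y`, `σ^z`, these are two linear conditions
on its three coefficients, solved up to scale. -/
theorem isBoundaryState_odd_twist_x (τ η : ℂ) (n : ℕ) (a : ℂ) :
    IsBoundaryState τ η (pauli 0) 1 (productState fun j : Fin (2 * n + 1) =>
      if Even (j.val + 1) then ![a, 1] else ![1, a]) := by
  let M : (Fin 4 → ℂ) → Matrix (Fin 2) (Fin 2) ℂ := fun w =>
    !![(1 - a ^ 2) * w 1 * w 2 - (1 + a ^ 2) * w 1 * w 3, 2 * a * w 2 * w 3;
       -(2 * a * w 2 * w 3), (1 - a ^ 2) * w 1 * w 2 + (1 + a ^ 2) * w 1 * w 3]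
  let N : (Fin 4 → ℂ) → Matrix (Fin 2) (Fin 2) ℂ := fun w =>
    !![(1 - a ^ 2) * w 1 * w 2 + (1 + a ^ 2) * w 1 * w 3, -(2 * a * w 2 * w 3);
       2 * a * w 2 * w 3, (1 - a ^ 2) * w 1 * w 2 - (1 + a ^ 2) * w 1 * w 3]
  have hdet : ∀ w, (M w).det = ((1 - a ^ 2) * w 1 * w 2) ^ 2 - ((1 + a ^ 2) * w 1 * w 3) ^ 2 +
      (2 * a * w 2 * w 3) ^ 2 := by
    intro w
    rw [Matrix.det_fin_two_of]
    ring
  refine isBoundaryState_alternating τ η n _ 1 1 ![1, a] ![a, 1] M N (one_pow _) ?_ ?_ ?_ ?_ ?_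
  · intro w p
    fin_cases p <;> ext i j <;> fin_cases i <;> fin_cases j <;>
      simp [M, N, siteEntry_zero, siteEntry_one, negLast, Matrix.mul_apply, Fin.sum_univ_two] <;>
      ring
  · intro w p
    fin_cases p <;> ext i j <;> fin_cases i <;> fin_cases j <;>
      simp [M, N, siteEntry_zero, siteEntry_one, negLast, Matrix.mul_apply, Fin.sum_univ_two] <;>
      ring
  · intro w
    ext i j
    fin_cases i <;> fin_cases j <;>
      simp [M, N, pauli, sigma, Matrix.mul_apply, Fin.sum_univ_two]
  · simp only [hdet]
    fun_prop
  · by_cases ha : a = 0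
    · exact ⟨![0, 1, 1, 0], by simp [hdet, ha]⟩
    · exact ⟨![0, 0, 1, 1], by simp [hdet, ha]⟩

/-- As for `σ^x`, with `N` a combination of `1`, `σ^x`, `σ^z`. -/
theorem isBoundaryState_odd_twist_y (τ η : ℂ) (n : ℕ) (a : ℂ) :
    IsBoundaryState τ η (pauli 1) 1 (productState fun j : Fin (2 * n + 1) =>
      if Even (j.val + 1) then ![-Complex.I * a, Complex.I] else ![1, a]) := by
  let M : (Fin 4 → ℂ) → Matrix (Fin 2) (Fin 2) ℂ := fun w =>
    !![(1 + a ^ 2) * w 0 * w 2 - (1 - a ^ 2) * w 0 * w 3, -(2 * a * w 2 * w 3);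
       -(2 * a * w 2 * w 3), (1 + a ^ 2) * w 0 * w 2 + (1 - a ^ 2) * w 0 * w 3]
  let N : (Fin 4 → ℂ) → Matrix (Fin 2) (Fin 2) ℂ := fun w =>
    !![(1 + a ^ 2) * w 0 * w 2 + (1 - a ^ 2) * w 0 * w 3, 2 * a * w 2 * w 3;
       2 * a * w 2 * w 3, (1 + a ^ 2) * w 0 * w 2 - (1 - a ^ 2) * w 0 * w 3]
  have hdet : ∀ w, (M w).det = ((1 + a ^ 2) * w 0 * w 2) ^ 2 - ((1 - a ^ 2) * w 0 * w 3) ^ 2 -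
      (2 * a * w 2 * w 3) ^ 2 := by
    intro w
    rw [Matrix.det_fin_two_of]
    ring
  refine isBoundaryState_alternating τ η n _ 1 1 ![1, a] ![-Complex.I * a, Complex.I] M N (one_pow _) ?_ ?_ ?_ ?_ ?_
  · intro w p
    fin_cases p <;> ext i j <;> fin_cases i <;> fin_cases j <;>
      simp [M, N, siteEntry_zero, siteEntry_one, negLast, Matrix.mul_apply, Fin.sum_univ_two] <;>
      ring
  · intro w p
    fin_cases p <;> ext i j <;> fin_cases i <;> fin_cases j <;>
      simp [M, N, siteEntry_zero, siteEntry_one, negLast, Matrix.mul_apply, Fin.sum_univ_two] <;>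
      ring
  · intro w
    ext i j
    fin_cases i <;> fin_cases j <;>
      simp [M, N, pauli, sigma, Matrix.mul_apply, Fin.sum_univ_two] <;> ring
  · simp only [hdet]
    fun_prop
  · by_cases ha : a = 0
    · exact ⟨![1, 0, 1, 0], by simp [hdet, ha]⟩
    · exact ⟨![0, 0, 1, 1], by simp [hdet, ha]⟩

/-- As for `σ^x`, with `N` a combination of `1`, `σ^x`, `σ^y`. -/
theorem isBoundaryState_odd_twist_z (τ η : ℂ) (n : ℕ) (a : ℂ) :
    IsBoundaryState τ η (pauli 2) 1 (productState fun j : Fin (2 * n + 1) =>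
      if Even (j.val + 1) then ![1, -a] else ![1, a]) := by
  let M : (Fin 4 → ℂ) → Matrix (Fin 2) (Fin 2) ℂ := fun w =>
    !![2 * a * w 0 * w 1, -((1 + a ^ 2) * w 1 * w 3) - (1 - a ^ 2) * w 0 * w 3;
       -((1 + a ^ 2) * w 1 * w 3) + (1 - a ^ 2) * w 0 * w 3, 2 * a * w 0 * w 1]
  let N : (Fin 4 → ℂ) → Matrix (Fin 2) (Fin 2) ℂ := fun w =>
    !![2 * a * w 0 * w 1, (1 + a ^ 2) * w 1 * w 3 + (1 - a ^ 2) * w 0 * w 3;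
       (1 + a ^ 2) * w 1 * w 3 - (1 - a ^ 2) * w 0 * w 3, 2 * a * w 0 * w 1]
  have hdet : ∀ w, (M w).det = (2 * a * w 0 * w 1) ^ 2 - ((1 + a ^ 2) * w 1 * w 3) ^ 2 +
      ((1 - a ^ 2) * w 0 * w 3) ^ 2 := by
    intro w
    rw [Matrix.det_fin_two_of]
    ring
  refine isBoundaryState_alternating τ η n _ 1 1 ![1, a] ![1, -a] M N (one_pow _) ?_ ?_ ?_ ?_ ?_
  · intro w p
    fin_cases p <;> ext i j <;> fin_cases i <;> fin_cases j <;>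
      simp [M, N, siteEntry_zero, siteEntry_one, negLast, Matrix.mul_apply, Fin.sum_univ_two] <;>
      ring
  · intro w p
    fin_cases p <;> ext i j <;> fin_cases i <;> fin_cases j <;>
      simp [M, N, siteEntry_zero, siteEntry_one, negLast, Matrix.mul_apply, Fin.sum_univ_two] <;>
      ring
  · intro w
    ext i j
    fin_cases i <;> fin_cases j <;>
      simp [M, N, pauli, sigma, Matrix.mul_apply, Fin.sum_univ_two] <;> ring
  · simp only [hdet]
    fun_prop
  · by_cases ha : a = 0
    · exact ⟨![0, 1, 0, 1], by simp [hdet, ha]⟩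
    · exact ⟨![1, 1, 0, 0], by simp [hdet, ha]⟩

theorem isBoundaryState_odd_twist (τ η : ℂ) (n : ℕ) (α : Fin 3) (a : ℂ) :
    IsBoundaryState τ η (pauli α) 1
      (evenSigma (2 * n + 1) α *ᵥ productState fun _ : Fin (2 * n + 1) => ![1, a]) := by
  rw [evenSigma_mulVec_productState]
  have hx : pauli 0 *ᵥ ![1, a] = ![a, 1] := by
    ext i; fin_cases i <;> simp [pauli, sigma]
  have hy : pauli 1 *ᵥ ![1, a] = ![-Complex.I * a, Complex.I] := by
    ext i; fin_cases i <;> simp [pauli, sigma, mul_comm]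
  have hz : pauli 2 *ᵥ ![1, a] = ![1, -a] := by
    ext i; fin_cases i <;> simp [pauli, sigma]
  fin_cases α
  · have h := isBoundaryState_odd_twist_x τ η n a
    rwa [← hx] at h
  · have h := isBoundaryState_odd_twist_y τ η n a
    rwa [← hy] at h
  · have h := isBoundaryState_odd_twist_z τ η n a
    rwa [← hz] at h

/-! ### Compatibility with the twist -/

theorem pauliSum_injective : Function.Injective pauliSum := by
  intro κ κ' h
  rw [pauliSum_eq, pauliSum_eq] at h
  have e00 : κ 3 + κ 2 = κ' 3 + κ' 2 := congrFun (congrFun h 0) 0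
  have e01 : κ 0 - Complex.I * κ 1 = κ' 0 - Complex.I * κ' 1 := congrFun (congrFun h 0) 1
  have e10 : κ 0 + Complex.I * κ 1 = κ' 0 + Complex.I * κ' 1 := congrFun (congrFun h 1) 0
  have e11 : κ 3 - κ 2 = κ' 3 - κ' 2 := congrFun (congrFun h 1) 1
  have h0 : κ 0 = κ' 0 := by linear_combination (e01 + e10) / 2
  have h1 : κ 1 = κ' 1 :=
    mul_left_cancel₀ Complex.I_ne_zero (by linear_combination (e10 - e01) / 2)
  have h2 : κ 2 = κ' 2 := by linear_combination (e00 - e11) / 2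
  have h3 : κ 3 = κ' 3 := by linear_combination (e00 + e11) / 2
  funext i
  fin_cases i <;> assumption

theorem pauli_mul_self (α : Fin 3) : pauli α * pauli α = 1 := by
  fin_cases α <;> ext i j <;> fin_cases i <;> fin_cases j <;>
    simp [pauli, sigma, Matrix.mul_apply, Fin.sum_univ_two]

theorem sigma_mul_pauli (α : Fin 3) (i : Fin 4) :
    sigma i * pauli α =
      (if i = 3 ∨ i = α.castSucc then (1 : ℂ) else -1) • (pauli α * sigma i) := by
  fin_cases α <;> fin_cases i <;> ext i j <;> fin_cases i <;> fin_cases j <;> simp [pauli, sigma]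

/-- If `K` commutes with the twist up to the factor `ε`, then so does each Pauli matrix occurring
in `K`. -/
theorem eq_zero_or_of_pauliSum_mul (κ : Fin 4 → ℂ) (α : Fin 3) {ε : ℂ}
    (h : pauliSum κ * pauli α = ε • (pauli α * pauliSum κ)) (i : Fin 4) :
    κ i = 0 ∨ sigma i * pauli α = ε • (pauli α * sigma i) := by
  let χ : Fin 4 → ℂ := fun i => if i = 3 ∨ i = α.castSucc then 1 else -1
  have h1 : pauliSum κ * pauli α = pauli α * pauliSum (χ * κ) := by
    simp only [pauliSum, Matrix.sum_mul, Matrix.mul_sum]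
    refine Finset.sum_congr rfl fun j _ => ?_
    rw [Matrix.smul_mul, sigma_mul_pauli, Matrix.mul_smul, smul_smul, mul_comm]
    rfl
  have h2 : ε • (pauli α * pauliSum κ) = pauli α * pauliSum (ε • κ) := by
    rw [← Matrix.mul_smul]
    simp only [pauliSum, Finset.smul_sum, smul_smul, Pi.smul_apply, smul_eq_mul]
  rw [h1, h2] at h
  have h3 := congrArg (pauli α * ·) h
  simp only [← Matrix.mul_assoc, pauli_mul_self, Matrix.one_mul] at h3
  have h4 : χ i * κ i = ε * κ i := congrFun (pauliSum_injective h3) i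
  by_cases hi : κ i = 0
  · exact Or.inl hi
  · right
    rw [← mul_right_cancel₀ hi h4]
    exact sigma_mul_pauli α i

theorem exists_sigma_mul_pauli (α : Fin 3) {ε : ℂ} (hε : ε = 1 ∨ ε = -1) :
    ∃ i, sigma i * pauli α = ε • (pauli α * sigma i) := by
  rcases hε with rfl | rfl
  · exact ⟨3, by simp [sigma]⟩
  · refine ⟨![1, 0, 0] α, ?_⟩
    fin_cases α <;> simp [pauli, sigma]

theorem exists_pauliSum_mul (P : Matrix (Fin 2) (Fin 2) ℂ) :
    ∃ κ, pauliSum κ * pauli 1 = P := by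
  have hI := Complex.I_mul_I
  refine ⟨![Complex.I * (P 1 1 - P 0 0) / 2, (P 0 0 + P 1 1) / 2,
    Complex.I * (P 0 1 + P 1 0) / 2, Complex.I * (P 0 1 - P 1 0) / 2], ?_⟩
  rw [pauliSum_eq]
  ext i j
  fin_cases i <;> fin_cases j <;> simp [pauli, sigma, Matrix.mul_apply, Fin.sum_univ_two]
  · linear_combination -P 0 0 * hI
  · linear_combination -P 0 1 * hI
  · linear_combination -P 1 0 * hI
  · linear_combination -P 1 1 * hI

theorem kPair_eq (τ η : ℂ) (c : Fin 4 → ℂ) :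
    kPair τ η c = pauliSum (fun i => c i / kFun τ i (η / 2)) * pauli 1 := rfl

/-- `σ^y Kᵗ σ^y` is the adjugate of `K`: the signs of `σ^x`, `σ^y`, `σ^z` are reversed. -/
theorem pauli_one_mul_transpose_mul (κ : Fin 4 → ℂ) :
    pauli 1 * (pauliSum κ)ᵀ * pauli 1 = pauliSum ![-κ 0, -κ 1, -κ 2, κ 3] := by
  have hT : (pauliSum κ)ᵀ =
      !![κ 3 + κ 2, κ 0 + Complex.I * κ 1; κ 0 - Complex.I * κ 1, κ 3 - κ 2] := by
    rw [pauliSum_eq]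
    ext i j
    fin_cases i <;> fin_cases j <;> rfl
  rw [hT, pauliSum_eq]
  ext i j
  fin_cases i <;> fin_cases j <;> simp [pauli, sigma, Matrix.mul_apply, Fin.sum_univ_two]
  · linear_combination -(κ 3 - κ 2) * Complex.I_mul_I
  · linear_combination (κ 0 - Complex.I * κ 1) * Complex.I_mul_I
  · linear_combination (κ 0 + Complex.I * κ 1) * Complex.I_mul_I
  · linear_combination -(κ 3 + κ 2) * Complex.I_mul_I

/-- The criterion in terms of the two-site vector `P`, whose `K`-matrix is `P σ^y`. -/
theorem isBoundaryState_of_commute (τ η : ℂ) (n : ℕ) (α : Fin 3) (P : Matrix (Fin 2) (Fin 2) ℂ)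
    {ε : ℂ} (hε : ε = 1 ∨ ε = -1)
    (h : P * pauli 1 * pauli α = ε • (pauli α * (P * pauli 1))) :
    IsBoundaryState τ η (pauli α) ε (pairState n P) := by
  obtain ⟨κ, rfl⟩ := exists_pauliSum_mul P
  rw [Matrix.mul_assoc (pauliSum κ), pauli_mul_self, Matrix.mul_one] at h
  exact isBoundaryState_pairState τ η n κ _ ε (eq_zero_or_of_pauliSum_mul κ α h)
    (exists_sigma_mul_pauli α hε)

theorem pauli_one_mul_pauli (α : Fin 3) : pauli 1 * pauli α = -((pauli α)ᵀ * pauli 1) := by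
  fin_cases α <;> ext i j <;> fin_cases i <;> fin_cases j <;>
    simp [pauli, sigma, Matrix.mul_apply, Fin.sum_univ_two]

/-- The `K`-matrix of a tensor product of eigenvectors of `σ^α` commutes or anticommutes with
`σ^α`. -/
theorem vecMulVec_mul_pauli (α : Fin 3) {φ ψ : Fin 2 → ℂ} {s t ε : ℂ}
    (hφ : pauli α *ᵥ φ = s • φ) (hψ : pauli α *ᵥ ψ = t • ψ) (h : ε * s = -t) :
    vecMulVec φ ψ * pauli 1 * pauli α = ε • (pauli α * (vecMulVec φ ψ * pauli 1)) := by
  rw [Matrix.mul_assoc, pauli_one_mul_pauli, ← Matrix.mul_assoc, Matrix.mul_neg,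
    ← Matrix.mul_assoc, Matrix.vecMulVec_mul, Matrix.mul_vecMulVec, Matrix.vecMul_transpose,
    hφ, hψ, Matrix.vecMulVec_smul, Matrix.smul_vecMulVec, Matrix.smul_mul, Matrix.smul_mul,
    smul_smul, h, neg_smul]

end
end XYZ

theorem mainTheorem4 (τ η : ℂ) (hτ : 0 < τ.im)
    (hη : ∀ i : Fin 4, XYZ.kFun τ i (η / 2) ≠ 0) :
    -- even length, periodic: the states built from the `K`-matrix
    (∀ (n : ℕ) (c : Fin 4 → ℂ),
      XYZ.IsBoundaryState τ η 1 1 (XYZ.pairState n (XYZ.kPair τ η c))) ∧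
    -- every two-site vector is of this form
    (∀ ψ : Matrix (Fin 2) (Fin 2) ℂ, ∃ c : Fin 4 → ℂ, XYZ.kPair τ η c = ψ) ∧
    -- even length, twist `σ^α`: the states built from a compatible `K`-matrix, both signs
    (∀ (n : ℕ) (α : Fin 3) (c : Fin 4 → ℂ) (ε : ℂ), (ε = 1 ∨ ε = -1) →
      XYZ.Compatible τ c (XYZ.pauli α) ε →
      XYZ.IsBoundaryState τ η (XYZ.pauli α) ε (XYZ.pairState n (XYZ.kPair τ η c))) ∧
    -- even length, twist `σ^α`: the explicit states `Ψ_{+,e}` and `Ψ_{-,e}`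
    (∀ (n : ℕ) (α : Fin 3) (φp φm : Fin 2 → ℂ) (ap am : ℂ),
      (XYZ.pauli α).mulVec φp = φp → (XYZ.pauli α).mulVec φm = -φm →
      XYZ.IsBoundaryState τ η (XYZ.pauli α) 1
        (XYZ.pairState n (ap • Matrix.vecMulVec φp φm + am • Matrix.vecMulVec φm φp)) ∧
      XYZ.IsBoundaryState τ η (XYZ.pauli α) (-1)
        (XYZ.pairState n (ap • Matrix.vecMulVec φp φp + am • Matrix.vecMulVec φm φm))) ∧
    -- odd length, periodic
    (∀ (n : ℕ) (a : ℂ),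
      XYZ.IsBoundaryState τ η 1 (-1)
        (XYZ.productState fun _ : Fin (2 * n + 1) => ![1, a])) ∧
    -- odd length, twist `σ^α`
    (∀ (n : ℕ) (α : Fin 3) (a : ℂ),
      XYZ.IsBoundaryState τ η (XYZ.pauli α) 1
        ((XYZ.evenSigma (2 * n + 1) α).mulVec
          (XYZ.productState fun _ : Fin (2 * n + 1) => ![1, a]))) := by
  refine ⟨fun n c => ?_, fun ψ => ?_, fun n α c ε hε hc => ?_, fun n α φp φm ap am hp hm => ?_,
    fun n a => XYZ.isBoundaryState_odd τ η n a,
    fun n α a => XYZ.isBoundaryState_odd_twist τ η n α a⟩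
  · rw [XYZ.kPair_eq]
    exact XYZ.isBoundaryState_pairState τ η n _ 1 1 (fun i => Or.inr (by simp)) ⟨0, by simp⟩
  · obtain ⟨κ, hκ⟩ := XYZ.exists_pauliSum_mul ψ
    refine ⟨fun i => κ i * XYZ.kFun τ i (η / 2), ?_⟩
    rw [XYZ.kPair_eq, ← hκ]
    simp only [mul_div_cancel_right₀ _ (hη _)]
  · rw [XYZ.kPair_eq]
    -- At `u = -η/2` the compatibility condition is about the matrix that defines the state.
    have h := hc (-(η / 2)) (by simpa using hη)
    rw [neg_neg] at h
    change XYZ.pauli 1 * (XYZ.pauliSum fun i => c i / XYZ.kFun τ i (η / 2)).transpose *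
      XYZ.pauli 1 * XYZ.pauli α = ε • (XYZ.pauli α * (XYZ.pauli 1 *
      (XYZ.pauliSum fun i => c i / XYZ.kFun τ i (η / 2)).transpose * XYZ.pauli 1)) at h
    rw [XYZ.pauli_one_mul_transpose_mul] at h
    refine XYZ.isBoundaryState_pairState τ η n _ _ ε (fun i => ?_) (XYZ.exists_sigma_mul_pauli α hε)
    refine (XYZ.eq_zero_or_of_pauliSum_mul _ α h i).imp_left fun hi => ?_
    fin_cases i <;> simpa using hi
  · have hp' : (XYZ.pauli α).mulVec φp = (1 : ℂ) • φp := by rw [hp, one_smul]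
    have hm' : (XYZ.pauli α).mulVec φm = (-1 : ℂ) • φm := by rw [hm, neg_one_smul]
    constructor
    · refine XYZ.isBoundaryState_of_commute τ η n α _ (Or.inl rfl) ?_
      simp only [Matrix.add_mul, Matrix.mul_add, Matrix.smul_mul, Matrix.mul_smul, smul_add]
      rw [XYZ.vecMulVec_mul_pauli (ε := 1) α hp' hm' (by norm_num),
        XYZ.vecMulVec_mul_pauli (ε := 1) α hm' hp' (by norm_num), smul_comm ap, smul_comm am]
    · refine XYZ.isBoundaryState_of_commute τ η n α _ (Or.inr rfl) ?_
      simp only [Matrix.add_mul, Matrix.mul_add, Matrix.smul_mul, Matrix.mul_smul, smul_add]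
      rw [XYZ.vecMulVec_mul_pauli (ε := -1) α hp' hp' (by norm_num),
        XYZ.vecMulVec_mul_pauli (ε := -1) α hm' hm' (by norm_num), smul_comm ap, smul_comm am]
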